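/- Let $L$ be an indexed language over a finite alphabet $\Sigma$, that is, the language generated by an indexed grammar: finitely many nonterminals, indices and productions of the forms $A \to \alpha$, $A \to Bf$ and $Af \to \alpha$, where $A, B$ are nonterminals, $f$ is an index and $\alpha$ is a word of terminals and nonterminals. A production $A\to\alpha$ (respectively $Af\to\alpha$) rewrites an occurrence of $A\delta$ (respectively $Af\delta$), $\delta$ a string of indices, to the word obtained from $\alpha$ by attaching $\delta$ to each nonterminal; a production $A\to Bf$ rewrites $A\delta$ to $Bf\delta$. The generated language is the set of all terminal words derivable from the sentence symbol with empty index string. Then there is a positive integer $k$ such that for every $w \in L$ with $|w| > k$ there exists $v \in L$ with $\frac{1}{k}|w| \le |v| < |w|$, where $|\cdot|$ denotes the length of a word. -/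

import Mathlib

/-- A production of an indexed grammar with terminals `T`, nonterminals `N` and indices `F`. -/
inductive IndexedRule (T N F : Type*) where
  /-- The production `A → α`, with `α` a word of terminals and nonterminals. -/
  | expand (A : N) (α : List (Symbol T N)) : IndexedRule T N F
  /-- The production `A → B f`. -/
  | push (A B : N) (f : F) : IndexedRule T N F
  /-- The production `A f → α`, with `α` a word of terminals and nonterminals. -/
  | pop (A : N) (f : F) (α : List (Symbol T N)) : IndexedRule T N F

/-- An indexed grammar (in the sense of Hopcroft and Ullman) over the terminal alphabet `T`. As for
`ContextFreeGrammar`, the finite types of nonterminals and of indices may be taken in `Type`. -/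
structure IndexedGrammar (T : Type*) where
  /-- The nonterminals. -/
  NT : Type
  /-- The indices. -/
  Idx : Type
  /-- There are finitely many nonterminals. -/
  finite_NT : Finite NT
  /-- There are finitely many indices. -/
  finite_Idx : Finite Idx
  /-- The sentence symbol. -/
  initial : NT
  /-- The productions. -/
  rules : Set (IndexedRule T NT Idx)
  /-- There are finitely many productions. -/
  finite_rules : rules.Finite

namespace IndexedGrammar

/-- A sentential form: a word whose letters are terminals and nonterminals carrying a string of
indices; the head of the list is the index next to the nonterminal. -/
abbrev SententialForm {T : Type*} (g : IndexedGrammar T) : Type _ :=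
  List (Symbol T (g.NT × List g.Idx))

/-- Attach the index string `δ` to every nonterminal of a word (and to no terminal). -/
def attach {T N F : Type*} (δ : List F) (α : List (Symbol T N)) :
    List (Symbol T (N × List F)) :=
  α.map fun x => match x with
    | Symbol.terminal a => Symbol.terminal a
    | Symbol.nonterminal A => Symbol.nonterminal (A, δ)

/-- One derivation step, inside an arbitrary context `β _ γ`. -/
inductive Produces {T : Type*} (g : IndexedGrammar T) : g.SententialForm → g.SententialForm → Prop
  /-- By `A → α`, the symbol `A δ` becomes `α` with `δ` attached to its nonterminals. -/
  | expand (A : g.NT) (α : List (Symbol T g.NT)) (h : IndexedRule.expand A α ∈ g.rules)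
      (δ : List g.Idx) (β γ : g.SententialForm) :
      Produces g (β ++ [Symbol.nonterminal (A, δ)] ++ γ) (β ++ attach δ α ++ γ)
  /-- By `A → B f`, the symbol `A δ` becomes `B f δ`. -/
  | push (A B : g.NT) (f : g.Idx) (h : IndexedRule.push A B f ∈ g.rules)
      (δ : List g.Idx) (β γ : g.SententialForm) :
      Produces g (β ++ [Symbol.nonterminal (A, δ)] ++ γ)
        (β ++ [Symbol.nonterminal (B, f :: δ)] ++ γ)
  /-- By `A f → α`, the symbol `A f δ` becomes `α` with `δ` attached to its nonterminals. -/
  | pop (A : g.NT) (f : g.Idx) (α : List (Symbol T g.NT)) (h : IndexedRule.pop A f α ∈ g.rules)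
      (δ : List g.Idx) (β γ : g.SententialForm) :
      Produces g (β ++ [Symbol.nonterminal (A, f :: δ)] ++ γ) (β ++ attach δ α ++ γ)

/-- Derivability in finitely many steps. -/
def Derives {T : Type*} (g : IndexedGrammar T) : g.SententialForm → g.SententialForm → Prop :=
  Relation.ReflTransGen g.Produces

/-- The language generated by `g`: the terminal words derivable from the sentence symbol with
empty index string. -/
def language {T : Type*} (g : IndexedGrammar T) : Language T :=
  { w : List T | g.Derives [Symbol.nonterminal (g.initial, [])] (w.map Symbol.terminal) }

end IndexedGrammar

/-- A language is indexed if it is generated by an indexed grammar. -/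
def Language.IsIndexed {T : Type*} (L : Language T) : Prop :=
  ∃ g : IndexedGrammar T, g.language = L

/-! Follow `A δ` until the topmost index of `δ` is consumed or, if `δ` is empty, until only
terminals remain. Its yield is then a concatenation of yields of letters that all carry the same
remaining string. Letters with empty yield can be erased, and whether this stays possible under
another index string depends only on the nullable set of that string. Hence finitely many sets
`reductions`, one for each top index, nullable set and nonterminal, describe the words that may
stand for the remaining letters.

Higman's lemma gives one `K` for all these sets: any word in one of them contains a subword of
length at most `K` in the same set, through any prescribed letter. If between `K + 1` and `n`
letters have nonempty yield, passing to such a subword through the letter of longest yield shortens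
the word strictly, and by a factor of at most `n` (`Decomposes.shrinks_or`).

Reading the derivation backwards (`shrinks_or_narrow`), each production raises the count from at
most `K` to at most `(c + K) * K`, where `c` bounds the right-hand sides. So either some step
shrinks the word, or the count is always at most `K`; in the latter case the sentence symbol, which
carries no index, yields at most `K` letters. -/

/-! ### Well-quasi-orders on words -/

/-- Every element of a set in a well-quasi-order lies above an element of bounded size. -/
theorem WellQuasiOrdered.exists_bound {α : Type*} {r : α → α → Prop} (hr : WellQuasiOrdered r)
    (size : α → ℕ) (D : Set α) : ∃ K, ∀ x ∈ D, ∃ y ∈ D, r y x ∧ size y ≤ K := by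
  by_contra! h
  choose x hx hlarge using h
  -- Each threshold dominates the sizes of the earlier bad elements, so a comparable pair
  -- contradicts the choice of the later one.
  let n : ℕ → ℕ := fun i => Nat.rec 0 (fun _ m => max m (size (x m))) i
  have hn (i : ℕ) : n (i + 1) = max (n i) (size (x (n i))) := rfl
  have hmono : Monotone n := monotone_nat_of_le_succ fun i => (hn i).symm ▸ le_max_left _ _
  obtain ⟨i, j, hij, hrel⟩ := hr fun i => x (n i)
  have h1 := hlarge (n j) (x (n i)) (hx _) hrel
  have h2 : n (i + 1) ≤ n j := hmono hij
  have h3 : size (x (n i)) ≤ n (i + 1) := (hn i).symm ▸ le_max_right _ _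
  omega

/-- Higman's lemma for words over a finite alphabet. -/
theorem List.wellQuasiOrdered_sublist {α : Type*} [Finite α] :
    WellQuasiOrdered (List.Sublist (α := α)) := by
  have h := Set.PartiallyWellOrderedOn.partiallyWellOrderedOn_sublistForall₂ (α := α) (· = ·)
    (s := Set.univ) (Set.finite_univ.partiallyWellOrderedOn)
  intro f
  obtain ⟨i, j, hij, hr⟩ := h fun n => ⟨f n, by simp⟩
  refine ⟨i, j, hij, ?_⟩
  obtain ⟨l, hl, hs⟩ := List.sublistForall₂_iff.1 hr
  rw [List.forall₂_eq_eq_eq] at hl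
  subst hl
  exact hs

/-- In a set of words over a finite alphabet, every word with a marked letter contains a scattered
subword of bounded length that keeps the marked letter and lies in the set. -/
theorem List.exists_bound_sublist_of_mark {α : Type*} [Finite α] (D : Set (List α)) :
    ∃ K, ∀ l₁ a l₂, l₁ ++ a :: l₂ ∈ D → ∃ m₁ m₂, m₁.Sublist l₁ ∧ m₂.Sublist l₂ ∧
      m₁ ++ a :: m₂ ∈ D ∧ (m₁ ++ a :: m₂).length ≤ K := by
  have hw : WellQuasiOrdered (α := (List α × List α) × α) fun x y =>
      (x.1.1.Sublist y.1.1 ∧ x.1.2.Sublist y.1.2) ∧ x.2 = y.2 := by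
    have : IsPreorder (List α) List.Sublist :=
      { refl := List.Sublist.refl, trans := fun _ _ _ => List.Sublist.trans }
    have : IsPreorder (List α × List α) fun x y => x.1.Sublist y.1 ∧ x.2.Sublist y.2 :=
      { refl := fun _ => ⟨List.Sublist.refl _, List.Sublist.refl _⟩
        trans := fun _ _ _ h h' => ⟨h.1.trans h'.1, h.2.trans h'.2⟩ }
    exact (List.wellQuasiOrdered_sublist.prod List.wellQuasiOrdered_sublist).prod
      (Finite.wellQuasiOrdered (· = ·))
  obtain ⟨K, hK⟩ := hw.exists_bound (fun x => (x.1.1 ++ x.2 :: x.1.2).length)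
    {x | x.1.1 ++ x.2 :: x.1.2 ∈ D}
  refine ⟨K, fun l₁ a l₂ h => ?_⟩
  obtain ⟨⟨⟨m₁, m₂⟩, b⟩, hy, ⟨⟨h1, h2⟩, rfl⟩, hlen⟩ := hK ((l₁, l₂), a) h
  exact ⟨m₁, m₂, h1, h2, hy, hlen⟩

/-! ### Lists related letter by letter -/

namespace List

theorem Forall₂.exists_of_sublist {α β : Type*} {R : α → β → Prop} {l : List α} {us : List β}
    (h : Forall₂ R l us) {m : List α} (hm : m.Sublist l) :
    ∃ vs, vs.Sublist us ∧ Forall₂ R m vs := by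
  induction h generalizing m with
  | nil => exact ⟨[], Sublist.refl _, by simpa using hm⟩
  | @cons a u l us ha _ ih =>
    cases hm with
    | cons _ hm =>
      obtain ⟨vs, h1, h2⟩ := ih hm
      exact ⟨vs, h1.cons _, h2⟩
    | cons_cons _ hm =>
      obtain ⟨vs, h1, h2⟩ := ih hm
      exact ⟨u :: vs, h1.cons_cons _, .cons ha h2⟩

theorem forall₂_append_left_iff {α β : Type*} {R : α → β → Prop} {l₁ l₂ : List α} {us : List β} :
    Forall₂ R (l₁ ++ l₂) us ↔
      ∃ us₁ us₂, Forall₂ R l₁ us₁ ∧ Forall₂ R l₂ us₂ ∧ us = us₁ ++ us₂ := by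
  constructor
  · intro h
    refine ⟨us.take l₁.length, us.drop l₁.length, ?_, ?_, by simp⟩
    · simpa using forall₂_take l₁.length h
    · simpa using forall₂_drop l₁.length h
  · rintro ⟨us₁, us₂, h1, h2, rfl⟩
    exact rel_append h1 h2

theorem forall₂_append_right_iff {α β : Type*} {R : α → β → Prop} {l : List α} {us₁ us₂ : List β} :
    Forall₂ R l (us₁ ++ us₂) ↔
      ∃ l₁ l₂, Forall₂ R l₁ us₁ ∧ Forall₂ R l₂ us₂ ∧ l = l₁ ++ l₂ := by
  constructor
  · intro h
    refine ⟨l.take us₁.length, l.drop us₁.length, ?_, ?_, by simp⟩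
    · simpa using forall₂_take us₁.length h
    · simpa using forall₂_drop us₁.length h
  · rintro ⟨l₁, l₂, h1, h2, rfl⟩
    exact rel_append h1 h2

theorem length_flatten_le_mul {α : Type*} {n : ℕ} {us : List (List α)}
    (h : ∀ u ∈ us, u.length ≤ n) : us.flatten.length ≤ us.length * n := by
  induction us with
  | nil => simp
  | cons u us ih =>
    have h1 := h u (by simp)
    have h2 := ih fun v hv => h v (by simp [hv])
    simp only [flatten_cons, length_append, length_cons, Nat.add_mul]
    omega

/-- A longest member of a nonempty list of words, marked in the list. -/
theorem exists_mark_longest {α : Type*} {us : List (List α)} (h : us ≠ []) :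
    ∃ us₁ u us₂, us = us₁ ++ u :: us₂ ∧ us.flatten.length ≤ us.length * u.length := by
  classical
  obtain ⟨u, hu, hmax⟩ := us.toFinset.exists_max_image length
    (by simpa [List.toFinset_nonempty_iff] using h)
  obtain ⟨us₁, us₂, rfl⟩ := append_of_mem (mem_toFinset.1 hu)
  exact ⟨us₁, u, us₂, rfl, length_flatten_le_mul fun v hv => hmax v (mem_toFinset.2 hv)⟩

theorem Sublist.flatten_length_lt {α : Type*} {us vs : List (List α)} (h : vs.Sublist us)
    (hne : ∀ u ∈ us, u ≠ []) (hlt : vs.length < us.length) :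
    vs.flatten.length < us.flatten.length := by
  induction h with
  | slnil => simp at hlt
  | @cons vs us u h ih =>
    have := length_pos_iff.2 (hne u (by simp))
    have := h.flatten.length_le
    simp only [flatten_cons, length_append]
    omega
  | @cons_cons vs us u h ih =>
    have := ih (fun v hv => hne v (by simp [hv])) (by simpa using hlt)
    simp only [flatten_cons, length_append]
    omega

end List

/-! ### Derivations in context and above a fixed index string -/

namespace IndexedGrammar

variable {T : Type*}

/-- Put the index string `δ` below the indices of every nonterminal of a sentential form. -/
def appendIdx {N F : Type*} (δ : List F) (x : List (Symbol T (N × List F))) :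
    List (Symbol T (N × List F)) :=
  x.map fun s => match s with
    | Symbol.terminal a => Symbol.terminal a
    | Symbol.nonterminal (A, σ) => Symbol.nonterminal (A, σ ++ δ)

section Attach

variable {N F : Type*}

theorem attach_cons (δ : List F) (x : Symbol T N) (α : List (Symbol T N)) :
    attach δ (x :: α) = attach δ [x] ++ attach δ α := rfl

@[simp] theorem attach_append (δ : List F) (α β : List (Symbol T N)) :
    attach δ (α ++ β) = attach δ α ++ attach δ β := by
  simp [attach]

@[simp] theorem appendIdx_append (δ : List F) (x y : List (Symbol T (N × List F))) :
    appendIdx δ (x ++ y) = appendIdx δ x ++ appendIdx δ y := by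
  simp [appendIdx]

@[simp] theorem appendIdx_nil (δ : List F) :
    appendIdx δ ([] : List (Symbol T (N × List F))) = [] := rfl

@[simp] theorem appendIdx_cons_nonterminal (δ σ : List F) (A : N)
    (x : List (Symbol T (N × List F))) :
    appendIdx δ (Symbol.nonterminal (A, σ) :: x) =
      Symbol.nonterminal (A, σ ++ δ) :: appendIdx δ x := rfl

@[simp] theorem appendIdx_attach (δ σ : List F) (α : List (Symbol T N)) :
    appendIdx δ (attach σ α) = attach (σ ++ δ) α := by
  simp only [appendIdx, attach, List.map_map]
  refine List.map_congr_left fun x _ => ?_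
  cases x <;> rfl

end Attach

variable {g : IndexedGrammar T}

theorem Produces.append_context {x y : g.SententialForm} (h : g.Produces x y)
    (p q : g.SententialForm) : g.Produces (p ++ x ++ q) (p ++ y ++ q) := by
  cases h with
  | expand A α h δ β γ => simpa using Produces.expand A α h δ (p ++ β) (γ ++ q)
  | push A B f h δ β γ => simpa using Produces.push A B f h δ (p ++ β) (γ ++ q)
  | pop A f α h δ β γ => simpa using Produces.pop A f α h δ (p ++ β) (γ ++ q)

theorem Produces.appendIdx {x y : g.SententialForm} (h : g.Produces x y) (δ : List g.Idx) :
    g.Produces (appendIdx δ x) (appendIdx δ y) := by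
  cases h with
  | expand A α h σ β γ => simpa using Produces.expand A α h (σ ++ δ) (IndexedGrammar.appendIdx δ β) (IndexedGrammar.appendIdx δ γ)
  | push A B f h σ β γ => simpa using Produces.push A B f h (σ ++ δ) (IndexedGrammar.appendIdx δ β) (IndexedGrammar.appendIdx δ γ)
  | pop A f α h σ β γ => simpa using Produces.pop A f α h (σ ++ δ) (IndexedGrammar.appendIdx δ β) (IndexedGrammar.appendIdx δ γ)

theorem Produces.derives {x y : g.SententialForm} (h : g.Produces x y) : g.Derives x y :=
  Relation.ReflTransGen.single h

theorem Derives.append_context {x y : g.SententialForm} (h : g.Derives x y)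
    (p q : g.SententialForm) : g.Derives (p ++ x ++ q) (p ++ y ++ q) :=
  Relation.ReflTransGen.lift (fun z => p ++ z ++ q)
    (fun _ _ h => Produces.append_context h p q) _ _ h

theorem Derives.appendIdx {x y : g.SententialForm} (h : g.Derives x y) (δ : List g.Idx) :
    g.Derives (appendIdx δ x) (appendIdx δ y) :=
  Relation.ReflTransGen.lift (IndexedGrammar.appendIdx δ)
    (fun _ _ h => Produces.appendIdx h δ) _ _ h

theorem Derives.trans {x y z : g.SententialForm} (h : g.Derives x y) (h' : g.Derives y z) :
    g.Derives x z :=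
  Relation.ReflTransGen.trans h h'

theorem Derives.append {x y x' y' : g.SententialForm} (h : g.Derives x y) (h' : g.Derives x' y') :
    g.Derives (x ++ x') (y ++ y') := by
  have h1 := h.append_context [] x'
  have h2 := h'.append_context y []
  simp only [List.nil_append, List.append_nil] at h1 h2
  exact h1.trans h2

theorem derives_expand {A : g.NT} {α : List (Symbol T g.NT)}
    (h : IndexedRule.expand A α ∈ g.rules) (δ : List g.Idx) :
    g.Derives [Symbol.nonterminal (A, δ)] (attach δ α) := by
  simpa using (Produces.expand A α h δ [] []).derives

theorem derives_push {A B : g.NT} {f : g.Idx} (h : IndexedRule.push A B f ∈ g.rules)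
    (δ : List g.Idx) :
    g.Derives [Symbol.nonterminal (A, δ)] [Symbol.nonterminal (B, f :: δ)] := by
  simpa using (Produces.push A B f h δ [] []).derives

theorem derives_pop {A : g.NT} {f : g.Idx} {α : List (Symbol T g.NT)}
    (h : IndexedRule.pop A f α ∈ g.rules) (δ : List g.Idx) :
    g.Derives [Symbol.nonterminal (A, f :: δ)] (attach δ α) := by
  simpa using (Produces.pop A f α h δ [] []).derives

/-! ### Yields, nullable letters and reductions -/

/-- The letter `x` with index string `δ` derives the terminal word `u`. -/
def Yields (g : IndexedGrammar T) (δ : List g.Idx) (x : Symbol T g.NT) (u : List T) : Prop :=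
  g.Derives (attach δ [x]) (u.map Symbol.terminal)

theorem derives_flatten_of_forall₂_yields {δ : List g.Idx} {α : List (Symbol T g.NT)}
    {us : List (List T)} (h : List.Forall₂ (g.Yields δ) α us) :
    g.Derives (attach δ α) (us.flatten.map Symbol.terminal) := by
  induction h with
  | nil => exact Relation.ReflTransGen.refl
  | cons hx _ ih =>
    rw [attach_cons, List.flatten_cons, List.map_append]
    exact Derives.append hx ih

/-- The number of nonempty words in a list of words. -/
def nonemptyCount (us : List (List T)) : ℕ := us.countP fun u => !u.isEmpty

@[simp] theorem nonemptyCount_nil : nonemptyCount ([] : List (List T)) = 0 := rfl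

@[simp] theorem nonemptyCount_append (us vs : List (List T)) :
    nonemptyCount (us ++ vs) = nonemptyCount us + nonemptyCount vs := by
  simp [nonemptyCount]

@[simp] theorem nonemptyCount_cons_nil (us : List (List T)) :
    nonemptyCount ([] :: us) = nonemptyCount us := by
  simp [nonemptyCount]

theorem nonemptyCount_cons_of_ne_nil {u : List T} (hu : u ≠ []) (us : List (List T)) :
    nonemptyCount (u :: us) = nonemptyCount us + 1 := by
  simp [nonemptyCount, hu]

theorem nonemptyCount_le_length (us : List (List T)) : nonemptyCount us ≤ us.length :=
  List.countP_le_length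

theorem nonemptyCount_eq_zero {us : List (List T)} (h : us.flatten = []) :
    nonemptyCount us = 0 := by
  simpa [nonemptyCount, List.countP_eq_zero] using h

/-- The letters that derive the empty word when they carry the index string `δ`. -/
def nullable (g : IndexedGrammar T) (δ : List g.Idx) : Set (Symbol T g.NT) := {x | g.Yields δ x []}

/-- The words `X` such that, for every index string `δ` with nullable set `E`, the nonterminal `A`
carrying `o` on top of `δ` derives every terminal word that `X` yields under `δ`. -/
def reductions (g : IndexedGrammar T) (o : Option g.Idx) (E : Set (Symbol T g.NT)) (A : g.NT) :
    Set (List (Symbol T g.NT)) :=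
  {X | ∀ δ, g.nullable δ = E → ∀ vs, List.Forall₂ (g.Yields δ) X vs →
    g.Derives [Symbol.nonterminal (A, o.toList ++ δ)] (vs.flatten.map Symbol.terminal)}

/-- Deleting the letters that yield the empty word. -/
theorem exists_forall₂_ne_nil {δ : List g.Idx} {α : List (Symbol T g.NT)} {us : List (List T)}
    (h : List.Forall₂ (g.Yields δ) α us) :
    ∃ X vs, List.Forall₂ (g.Yields δ) X vs ∧ (∀ v ∈ vs, v ≠ []) ∧ vs.flatten = us.flatten ∧
      vs.length = nonemptyCount us ∧
      ∀ δ', g.nullable δ' = g.nullable δ → ∀ vs', List.Forall₂ (g.Yields δ') X vs' →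
        g.Derives (attach δ' α) (vs'.flatten.map Symbol.terminal) := by
  induction h with
  | nil =>
    refine ⟨[], [], .nil, by simp, rfl, rfl, fun δ' _ vs' h => ?_⟩
    rw [List.forall₂_nil_left_iff.1 h]
    exact Relation.ReflTransGen.refl
  | @cons x u α us hx _ ih =>
    obtain ⟨X, vs, h1, h2, h3, h4, h5⟩ := ih
    by_cases hu : u = []
    · subst hu
      refine ⟨X, vs, h1, h2, by simpa using h3, by simpa using h4, fun δ' hδ vs' h => ?_⟩
      have hx' : g.Yields δ' x [] := by
        have : x ∈ g.nullable δ' := hδ ▸ hx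
        exact this
      rw [attach_cons]
      exact Derives.append hx' (h5 δ' hδ vs' h)
    · refine ⟨x :: X, u :: vs, .cons hx h1, ?_, by simp [h3], ?_, fun δ' hδ vs' h => ?_⟩
      · simpa [hu] using h2
      · simp [nonemptyCount_cons_of_ne_nil hu, h4]
      · obtain ⟨v, vs'', hv, hvs, rfl⟩ := List.forall₂_cons_left_iff.1 h
        rw [attach_cons, List.flatten_cons, List.map_append]
        exact Derives.append hv (h5 δ' hδ vs'' hvs)

/-! ### Shrinking by a bounded factor -/

/-- The sentential form `x` derives a word shorter than `w`, by at most the factor `k`. -/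
def Shrinks (g : IndexedGrammar T) (k : ℕ) (x : g.SententialForm) (w : List T) : Prop :=
  ∃ v : List T, g.Derives x (v.map Symbol.terminal) ∧ v.length < w.length ∧ w.length ≤ k * v.length

theorem Shrinks.of_derives {k : ℕ} {x y : g.SententialForm} {w : List T} (h : g.Shrinks k y w)
    (hxy : g.Derives x y) : g.Shrinks k x w := by
  obtain ⟨v, h1, h2, h3⟩ := h
  exact ⟨v, hxy.trans h1, h2, h3⟩

theorem Shrinks.append_context {k : ℕ} (hk : 0 < k) {x p q : g.SententialForm} {u v w : List T}
    (h : g.Shrinks k x w) (hp : g.Derives p (u.map Symbol.terminal))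
    (hq : g.Derives q (v.map Symbol.terminal)) : g.Shrinks k (p ++ x ++ q) (u ++ w ++ v) := by
  obtain ⟨w', h1, h2, h3⟩ := h
  refine ⟨u ++ w' ++ v, ?_, ?_, ?_⟩
  · simpa using (hp.append h1).append hq
  · simp only [List.length_append]
    omega
  · simp only [List.length_append, Nat.mul_add]
    have := Nat.le_mul_of_pos_left u.length hk
    have := Nat.le_mul_of_pos_left v.length hk
    omega

/-- A bound which works simultaneously for the finitely many sets of reductions. -/
theorem exists_reductions_bound [Finite T] (g : IndexedGrammar T) :
    ∃ K, 0 < K ∧ ∀ o E A l₁ a l₂, l₁ ++ a :: l₂ ∈ g.reductions o E A →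
      ∃ m₁ m₂, m₁.Sublist l₁ ∧ m₂.Sublist l₂ ∧ m₁ ++ a :: m₂ ∈ g.reductions o E A ∧
        (m₁ ++ a :: m₂).length ≤ K := by
  have := g.finite_NT
  have := g.finite_Idx
  have : Finite (Symbol T g.NT) := Finite.of_equiv _ (Symbol.proxyTypeEquiv T g.NT)
  choose K hK using fun p : Option g.Idx × Set (Symbol T g.NT) × g.NT =>
    List.exists_bound_sublist_of_mark (g.reductions p.1 p.2.1 p.2.2)
  obtain ⟨M, hM⟩ := (Set.finite_range K).bddAbove
  -- The successor only makes the bound positive.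
  refine ⟨M + 1, M.succ_pos, fun o E A l₁ a l₂ h => ?_⟩
  obtain ⟨m₁, m₂, h1, h2, h3, h4⟩ := hK (o, E, A) l₁ a l₂ h
  exact ⟨m₁, m₂, h1, h2, h3, h4.trans ((hM ⟨_, rfl⟩).trans M.le_succ)⟩

/-! ### Decompositions and narrow yields -/

/-- The nonterminal `A` carrying the indices `o` derives a word whose letters, once `o` has been
consumed, are related by `S` to words with concatenation `u`, at most `n` of them nonempty. -/
def Decomposes (g : IndexedGrammar T) (o : Option g.Idx) (S : Symbol T g.NT → List T → Prop)
    (n : ℕ) (A : g.NT) (u : List T) : Prop :=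
  ∃ α us, g.Derives [Symbol.nonterminal (A, o.toList)] (attach [] α) ∧ List.Forall₂ S α us ∧
    us.flatten = u ∧ nonemptyCount us ≤ n

/-- The letter `x` is a terminal and `u` is its yield, or it is a nonterminal for which `P` holds. -/
def LetterYield {N : Type*} (P : N → List T → Prop) : Symbol T N → List T → Prop
  | .terminal a, u => u = [a]
  | .nonterminal A, u => P A u

/-- Under the index string `δ`, the letter `x` yields `u` in such a way that, whenever the index
string loses its topmost index, the derived word has at most `n` letters with nonempty yield. -/
def Narrow (g : IndexedGrammar T) (n : ℕ) : List g.Idx → Symbol T g.NT → List T → Prop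
  | [] => LetterYield (g.Decomposes none (LetterYield fun _ _ => False) n)
  | f :: δ => LetterYield (g.Decomposes (some f) (Narrow g n δ) n)

/-- The relation governing the letters left after the topmost index, if any, is consumed. -/
def NarrowBelow (g : IndexedGrammar T) (n : ℕ) : List g.Idx → Symbol T g.NT → List T → Prop
  | [] => LetterYield fun _ _ => False
  | _ :: δ => Narrow g n δ

/-- Treats empty and nonempty index strings uniformly, so that later arguments need no case split on
`δ`. -/
theorem narrow_eq (n : ℕ) (δ : List g.Idx) :
    g.Narrow n δ = LetterYield (g.Decomposes δ.head? (g.NarrowBelow n δ) n) := by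
  cases δ <;> rfl

theorem toList_head?_append_tail {F : Type*} (δ : List F) : δ.head?.toList ++ δ.tail = δ := by
  cases δ <;> rfl

theorem yields_terminal (δ : List g.Idx) (a : T) : g.Yields δ (Symbol.terminal a) [a] :=
  Relation.ReflTransGen.refl

theorem Decomposes.derives {o : Option g.Idx} {S : Symbol T g.NT → List T → Prop} {n : ℕ}
    {A : g.NT} {u : List T} (h : g.Decomposes o S n A u) {δ : List g.Idx}
    (hS : ∀ x v, S x v → g.Yields δ x v) :
    g.Derives [Symbol.nonterminal (A, o.toList ++ δ)] (u.map Symbol.terminal) := by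
  obtain ⟨α, us, h1, h2, rfl, -⟩ := h
  have h3 := h1.appendIdx δ
  simp only [appendIdx_cons_nonterminal, appendIdx_nil, appendIdx_attach, List.nil_append] at h3
  exact h3.trans (derives_flatten_of_forall₂_yields (h2.imp hS))

theorem Narrow.yields {n : ℕ} {δ : List g.Idx} {x : Symbol T g.NT} {u : List T}
    (h : g.Narrow n δ x u) : g.Yields δ x u := by
  induction δ generalizing x u with
  | nil =>
    cases x with
    | terminal a => exact (show u = [a] from h) ▸ yields_terminal _ a
    | nonterminal A =>
      have h' : g.Decomposes none (LetterYield fun _ _ => False) n A u := h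
      refine h'.derives (δ := []) fun y v hy => ?_
      cases y with
      | terminal a => exact (show v = [a] from hy) ▸ yields_terminal _ a
      | nonterminal B => exact hy.elim
  | cons f δ ih =>
    cases x with
    | terminal a => exact (show u = [a] from h) ▸ yields_terminal _ a
    | nonterminal A =>
      have h' : g.Decomposes (some f) (g.Narrow n δ) n A u := h
      exact h'.derives (δ := δ) fun y v hy => ih hy

theorem narrowBelow_terminal (n : ℕ) (δ : List g.Idx) (a : T) :
    g.NarrowBelow n δ (Symbol.terminal a) [a] := by
  match δ with
  | [] => rfl
  | [_] => rfl
  | _ :: _ :: _ => rfl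

theorem NarrowBelow.yields {n : ℕ} {δ : List g.Idx} {x : Symbol T g.NT} {u : List T}
    (h : g.NarrowBelow n δ x u) : g.Yields δ.tail x u := by
  cases δ with
  | nil =>
    cases x with
    | terminal a => exact (show u = [a] from h) ▸ yields_terminal _ a
    | nonterminal A => exact False.elim h
  | cons f δ => exact Narrow.yields h

/-- A word of narrow letters decomposes as a whole. -/
theorem exists_decomposition_of_forall₂ {n : ℕ} (hn : 0 < n) {δ : List g.Idx}
    {α : List (Symbol T g.NT)} {us : List (List T)} (h : List.Forall₂ (g.Narrow n δ) α us) :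
    ∃ β vs, g.Derives (attach δ.head?.toList α) (attach [] β) ∧
      List.Forall₂ (g.NarrowBelow n δ) β vs ∧ vs.flatten = us.flatten ∧
      nonemptyCount vs ≤ nonemptyCount us * n := by
  induction h with
  | nil => exact ⟨[], [], Relation.ReflTransGen.refl, .nil, rfl, by simp⟩
  | @cons x u α us hx _ ih =>
    obtain ⟨β, vs, h1, h2, h3, h4⟩ := ih
    obtain ⟨γ, ws, k1, k2, k3, k4⟩ : ∃ γ ws, g.Derives (attach δ.head?.toList [x]) (attach [] γ) ∧
        List.Forall₂ (g.NarrowBelow n δ) γ ws ∧ ws.flatten = u ∧ nonemptyCount ws ≤ n := by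
      rw [narrow_eq] at hx
      cases x with
      | terminal a =>
        obtain rfl : u = [a] := hx
        exact ⟨[.terminal a], [[a]], Relation.ReflTransGen.refl,
          .cons (narrowBelow_terminal n δ a) .nil, rfl, hn⟩
      | nonterminal A => exact hx
    refine ⟨γ ++ β, ws ++ vs, ?_, List.rel_append k2 h2, by simp [h3, k3], ?_⟩
    · rw [attach_cons, attach_append]
      exact k1.append h1
    · rw [nonemptyCount_append]
      -- A letter with empty yield must add nothing to the count; otherwise the bound would depend
      -- on the number of letters.
      by_cases hu : u = []
      · subst hu
        rw [nonemptyCount_eq_zero k3, nonemptyCount_cons_nil]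
        omega
      · rw [nonemptyCount_cons_of_ne_nil hu, Nat.add_mul]
        omega

/-- A decomposition with a bounded number of nonempty yields can be reduced, or has few of them. -/
theorem Decomposes.shrinks_or {K n : ℕ} {o : Option g.Idx}
    (hK : ∀ E A l₁ a l₂, l₁ ++ a :: l₂ ∈ g.reductions o E A →
      ∃ m₁ m₂, m₁.Sublist l₁ ∧ m₂.Sublist l₂ ∧ m₁ ++ a :: m₂ ∈ g.reductions o E A ∧
        (m₁ ++ a :: m₂).length ≤ K)
    {δ : List g.Idx} {S : Symbol T g.NT → List T → Prop} (hS : ∀ x v, S x v → g.Yields δ x v)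
    {A : g.NT} {u : List T} (h : g.Decomposes o S n A u) :
    g.Shrinks n [Symbol.nonterminal (A, o.toList ++ δ)] u ∨ g.Decomposes o S K A u := by
  obtain ⟨α, us, h1, h2, rfl, h3⟩ := h
  by_cases hle : nonemptyCount us ≤ K
  · exact Or.inr ⟨α, us, h1, h2, rfl, hle⟩
  left
  -- Erasing empty yields is what makes every later deletion shorten the word strictly.
  obtain ⟨X, vs, k1, k2, k3, k4, k5⟩ := exists_forall₂_ne_nil (h2.imp hS)
  have hX : X ∈ g.reductions o (g.nullable δ) A := by
    intro δ' hδ vs' hvs'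
    have h4 := h1.appendIdx δ'
    simp only [appendIdx_cons_nonterminal, appendIdx_nil, appendIdx_attach, List.nil_append] at h4
    exact h4.trans (k5 δ' hδ vs' hvs')
  have hvs : vs ≠ [] := by
    rintro rfl
    simp at k4
    omega
  obtain ⟨vs₁, v, vs₂, rfl, hmax⟩ := List.exists_mark_longest hvs
  obtain ⟨X₁, Y, hX₁, hY, rfl⟩ := List.forall₂_append_right_iff.1 k1
  obtain ⟨a, X₂, ha, hX₂, rfl⟩ := List.forall₂_cons_right_iff.1 hY
  obtain ⟨m₁, m₂, hm₁, hm₂, hm, hlen⟩ := hK _ _ _ _ _ hX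
  obtain ⟨ws₁, hs₁, hw₁⟩ := hX₁.exists_of_sublist hm₁
  obtain ⟨ws₂, hs₂, hw₂⟩ := hX₂.exists_of_sublist hm₂
  have hw : List.Forall₂ (g.Yields δ) (m₁ ++ a :: m₂) (ws₁ ++ v :: ws₂) :=
    List.rel_append hw₁ (.cons ha hw₂)
  refine ⟨(ws₁ ++ v :: ws₂).flatten, hm δ rfl _ hw, ?_, ?_⟩
  · rw [← k3]
    refine List.Sublist.flatten_length_lt (hs₁.append (hs₂.cons_cons v)) k2 ?_
    rw [← hw.length_eq, k4]
    omega
  · rw [← k3]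
    -- At most `n` yields, none longer than the retained `v`.
    refine hmax.trans (Nat.mul_le_mul (k4 ▸ h3) ?_)
    simp only [List.flatten_append, List.flatten_cons, List.length_append]
    omega

/-! ### Backward induction along a derivation -/

/-- The relation `Narrow` for letters carrying their own index strings. -/
def NarrowForm (g : IndexedGrammar T) (n : ℕ) : Symbol T (g.NT × List g.Idx) → List T → Prop :=
  LetterYield fun p => g.Narrow n p.2 (Symbol.nonterminal p.1)

theorem forall₂_narrowForm_attach {n : ℕ} {δ : List g.Idx} {α : List (Symbol T g.NT)}
    {us : List (List T)} :
    List.Forall₂ (g.NarrowForm n) (attach δ α) us ↔ List.Forall₂ (g.Narrow n δ) α us := by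
  rw [attach, List.forall₂_map_left_iff]
  constructor
  all_goals
    refine fun h => h.imp fun x u hx => ?_
    cases x with
    | terminal a => simpa only [NarrowForm, narrow_eq, LetterYield] using hx
    | nonterminal A => exact hx

theorem derives_of_forall₂_narrowForm {n : ℕ} {x : g.SententialForm} {us : List (List T)}
    (h : List.Forall₂ (g.NarrowForm n) x us) :
    g.Derives x (us.flatten.map Symbol.terminal) := by
  induction h with
  | nil => exact Relation.ReflTransGen.refl
  | @cons s u x us hs _ ih =>
    rw [List.flatten_cons, List.map_append]
    refine Derives.append (x := [s]) ?_ ih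
    match s, hs with
    | .terminal a, hs => exact (show u = [a] from hs) ▸ Relation.ReflTransGen.refl
    | .nonterminal (A, δ), hs => exact Narrow.yields hs

/-- The right-hand sides of the productions have bounded length. -/
theorem exists_rule_length_bound (g : IndexedGrammar T) : ∃ c,
    (∀ A α, IndexedRule.expand A α ∈ g.rules → α.length ≤ c) ∧
    ∀ A f α, IndexedRule.pop A f α ∈ g.rules → α.length ≤ c := by
  let len : IndexedRule T g.NT g.Idx → ℕ
    | .expand _ α => α.length
    | .push _ _ _ => 0
    | .pop _ _ α => α.length
  obtain ⟨c, hc⟩ := (g.finite_rules.image len).bddAbove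
  exact ⟨c, fun A α h => hc ⟨_, h, rfl⟩, fun A f α h => hc ⟨_, h, rfl⟩⟩

theorem forall₂_terminal_narrowForm (n : ℕ) (w : List T) :
    List.Forall₂ (g.NarrowForm n) (w.map Symbol.terminal) (w.map fun a => [a]) := by
  induction w with
  | nil => exact .nil
  | cons a w ih => exact .cons rfl ih

/-- Replacing a nonterminal in a sentential form by something narrow or reducible. -/
theorem shrinks_or_narrow_of_context {k n : ℕ} (hk : 0 < k) {A : g.NT} {δ : List g.Idx}
    {y p q : g.SententialForm} {w : List T}
    (hy : ∀ us, List.Forall₂ (g.NarrowForm n) y us →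
      g.Shrinks k [Symbol.nonterminal (A, δ)] us.flatten ∨
        g.Narrow n δ (Symbol.nonterminal A) us.flatten)
    (h : ∃ us, List.Forall₂ (g.NarrowForm n) (p ++ y ++ q) us ∧ us.flatten = w) :
    g.Shrinks k (p ++ [Symbol.nonterminal (A, δ)] ++ q) w ∨
      ∃ us, List.Forall₂ (g.NarrowForm n) (p ++ [Symbol.nonterminal (A, δ)] ++ q) us ∧
        us.flatten = w := by
  obtain ⟨us, hus, rfl⟩ := h
  obtain ⟨us', us₃, hus', h3, rfl⟩ := List.forall₂_append_left_iff.1 hus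
  obtain ⟨us₁, us₂, h1, h2, rfl⟩ := List.forall₂_append_left_iff.1 hus'
  rcases hy us₂ h2 with h | h
  · left
    simpa using h.append_context hk (derives_of_forall₂_narrowForm h1)
      (derives_of_forall₂_narrowForm h3)
  · right
    exact ⟨us₁ ++ [us₂.flatten] ++ us₃, List.rel_append (List.rel_append h1 
      (.cons (show g.NarrowForm n (.nonterminal (A, δ)) _ from h) .nil)) h3,
      by simp⟩

/-- Induction from the terminal word back to `x`. Undoing a production affects one nonterminal,
whose new decomposition has at most `(c + K) * K` nonempty yields; it is then either cut down to `K`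
or gives a shrinking. -/
theorem shrinks_or_narrow {K c : ℕ} (hK0 : 0 < K)
    (hK : ∀ o E A l₁ a l₂, l₁ ++ a :: l₂ ∈ g.reductions o E A →
      ∃ m₁ m₂, m₁.Sublist l₁ ∧ m₂.Sublist l₂ ∧ m₁ ++ a :: m₂ ∈ g.reductions o E A ∧
        (m₁ ++ a :: m₂).length ≤ K)
    (hexpand : ∀ A α, IndexedRule.expand A α ∈ g.rules → α.length ≤ c)
    (hpop : ∀ A f α, IndexedRule.pop A f α ∈ g.rules → α.length ≤ c)
    {x : g.SententialForm} {w : List T} (h : g.Derives x (w.map Symbol.terminal)) :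
    g.Shrinks ((c + K) * K) x w ∨
      ∃ us, List.Forall₂ (g.NarrowForm K) x us ∧ us.flatten = w := by
  have hk : 0 < (c + K) * K := by positivity
  have key {A : g.NT} {δ : List g.Idx} {u : List T}
      (hd : g.Decomposes δ.head? (g.NarrowBelow K δ) ((c + K) * K) A u) :
      g.Shrinks ((c + K) * K) [Symbol.nonterminal (A, δ)] u ∨
        g.Narrow K δ (Symbol.nonterminal A) u := by
    have h1 := hd.shrinks_or (hK _) (δ := δ.tail) fun x v => NarrowBelow.yields
    rw [toList_head?_append_tail] at h1
    rwa [narrow_eq]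
  induction h using Relation.ReflTransGen.head_induction_on with
  | refl => exact Or.inr ⟨w.map fun a => [a], forall₂_terminal_narrowForm K w, by
      rw [← List.flatMap_def, List.flatMap_singleton']⟩
  | @head x y hxy _ ih =>
    rcases ih with ih | ih
    · exact Or.inl (ih.of_derives hxy.derives)
    cases hxy with
    | expand A α hr δ β γ =>
      refine shrinks_or_narrow_of_context hk (fun us hus => key ?_) ih
      have hus' := forall₂_narrowForm_attach.1 hus
      obtain ⟨α', vs, h1, h2, h3, h4⟩ := exists_decomposition_of_forall₂ hK0 hus'
      -- At most `c` letters, each contributing at most `K` nonempty yields.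
      refine ⟨α', vs, (derives_expand hr _).trans h1, h2, h3, h4.trans (Nat.mul_le_mul_right K ?_)⟩
      have := nonemptyCount_le_length us
      have := hus'.length_eq
      have := hexpand A α hr
      omega
    | push A B f hr δ β γ =>
      refine shrinks_or_narrow_of_context hk (fun us hus => key ?_) ih
      obtain ⟨u, us', hu, hnil, rfl⟩ := List.forall₂_cons_left_iff.1 hus
      obtain rfl := List.forall₂_nil_left_iff.1 hnil
      have hu' : g.Decomposes (some f) (g.Narrow K δ) K B u := hu
      obtain ⟨α, vs, h1, h2, rfl, h3⟩ := hu'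
      -- Consuming the pushed `f` leaves at most `K` nonempty yields; the top of `δ` is consumed
      -- next, giving at most `K * K`.
      obtain ⟨α', ws, k1, k2, k3, k4⟩ := exists_decomposition_of_forall₂ hK0 h2
      have h4 := h1.appendIdx δ.head?.toList
      simp only [appendIdx_cons_nonterminal, appendIdx_nil, appendIdx_attach,
        List.nil_append] at h4
      refine ⟨α', ws, ((derives_push hr _).trans h4).trans k1, k2, by simpa using k3,
        k4.trans (Nat.mul_le_mul_right K ?_)⟩
      omega
    | pop A f α hr δ β γ =>
      refine shrinks_or_narrow_of_context hk (fun us hus => key ?_) ih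
      have hus' := forall₂_narrowForm_attach.1 hus
      -- The production itself consumes the top index, so its right-hand side is already the
      -- decomposition.
      refine ⟨α, us, derives_pop hr [], hus', rfl, ?_⟩
      have := nonemptyCount_le_length us
      have := hus'.length_eq
      have := hpop A f α hr
      have : c ≤ (c + K) * K := (Nat.le_add_right c K).trans (Nat.le_mul_of_pos_right _ hK0)
      omega

/-- With no index, the decomposition consists of terminals only, each a nonempty yield of length
one. -/
theorem Narrow.length_le {n : ℕ} {A : g.NT} {u : List T}
    (h : g.Narrow n [] (Symbol.nonterminal A) u) : u.length ≤ n := by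
  obtain ⟨α, us, -, h2, rfl, h3⟩ := h
  refine le_trans ?_ h3
  clear h3
  induction h2 with
  | nil => simp
  | @cons x u α us hx _ ih =>
    cases x with
    | terminal a =>
      obtain rfl : u = [a] := hx
      rw [nonemptyCount_cons_of_ne_nil (by simp)]
      simp only [List.flatten_cons, List.length_append, List.length_singleton]
      omega
    | nonterminal B => exact hx.elim

/-- Long words of the language of an indexed grammar can be shortened by a bounded factor. -/
theorem exists_shrinking_constant [Finite T] (g : IndexedGrammar T) :
    ∃ k, 0 < k ∧ ∀ w ∈ g.language, k < w.length →
      ∃ v ∈ g.language, v.length < w.length ∧ w.length ≤ k * v.length := by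
  obtain ⟨K, hK0, hK⟩ := exists_reductions_bound g
  obtain ⟨c, hexpand, hpop⟩ := exists_rule_length_bound g
  refine ⟨(c + K) * K, by positivity, fun w hw hlen => ?_⟩
  rcases shrinks_or_narrow hK0 hK hexpand hpop hw with ⟨v, h1, h2, h3⟩ | ⟨us, hus, rfl⟩
  · exact ⟨v, h1, h2, h3⟩
  · obtain ⟨u, us', hu, hnil, rfl⟩ := List.forall₂_cons_left_iff.1 hus
    obtain rfl := List.forall₂_nil_left_iff.1 hnil
    have h1 : u.length ≤ K := Narrow.length_le hu
    have h2 : K ≤ (c + K) * K := Nat.le_mul_of_pos_left _ (by omega)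
    simp only [List.flatten_cons, List.flatten_nil, List.append_nil] at hlen
    omega

end IndexedGrammar

theorem corollary1 {T : Type*} [Finite T] (L : Language T) (hL : L.IsIndexed) :
    ∃ k : ℕ, 0 < k ∧ ∀ w ∈ L, k < w.length →
      ∃ v ∈ L, (1 / (k : ℝ)) * (w.length : ℝ) ≤ (v.length : ℝ) ∧ v.length < w.length := by
  obtain ⟨g, rfl⟩ := hL
  obtain ⟨k, hk, h⟩ := g.exists_shrinking_constant
  refine ⟨k, hk, fun w hw hlen => ?_⟩
  obtain ⟨v, hv, h1, h2⟩ := h w hw hlen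
  refine ⟨v, hv, ?_, h1⟩
  rw [one_div, inv_mul_le_iff₀ (by exact_mod_cast hk)]
  exact_mod_cast h2
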